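/- An (a,b)-module is a free $\mathbb{C}[[b]]$-module $E$ of finite type with a $\mathbb{C}$-linear map $a : E \to E$, continuous for the $b$-adic topology, such that $ab - ba = b^2$. The operator $a$ extends to $E[b^{-1}]$ with the same commutation relation, and $E^{\sharp} \subset E[b^{-1}]$ denotes the saturation of $E$ by $b^{-1}a$, i.e. the smallest $\mathbb{C}[[b]]$-submodule of $E[b^{-1}]$ that contains $E$ and is stable by $b^{-1}a$. The (a,b)-module $E$ is regular if $E^{\sharp}$ is finitely generated over $\mathbb{C}[[b]]$; its index $\delta(E)$ is then the smallest $m \in \mathbb{N}$ such that $E^{\sharp} \subset b^{-m}E$. Let $E_0 = \mathbb{C}[[b]]e_0$ be the rank one (a,b)-module with $a e_0 = 0$. The dual $E^*$ of $E$ is the (a,b)-module $\mathrm{Hom}_{\mathbb{C}[[b]]}(E, E_0)$ on which $S(b) \in \mathbb{C}[[b]]$ acts as multiplication by $S(-b)$, and $a$ acts by $(a\varphi)(e) = \varphi(a e) - a\,\varphi(e)$. Let $E$ be a regular (a,b)-module. Then $E^*$ is regular and $\delta(E^*) = \delta(E)$. -/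

import Mathlib

universe u v

open PowerSeries

/-! Throughout, `ℂ⟦X⟧` is the ring `ℂ[[b]]`, and the variable `X` is `b`. -/

namespace ABModule

section Identities

variable {R : Type v} [CommRing R] {E : Type u} [AddCommGroup E] [Module R E]

theorem aux_pow {t : R} {a : E →+ E}
    (h : ∀ x, a (t • x) = t • a x + t ^ 2 • x) (n : ℕ) (x : E) :
    a (t ^ n • x) = t ^ n • a x + ((n : R) * t ^ (n + 1)) • x := by
  induction n generalizing x with
  | zero => simp
  | succ k ih =>
    rw [pow_succ, mul_smul, ih, h]
    push_cast
    module

theorem aux_continuous_adic {t : R} {a : E →+ E}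
    (h : ∀ x, a (t • x) = t • a x + t ^ 2 • x) :
    @Continuous E E ((Ideal.span {t}).adicModuleTopology E)
      ((Ideal.span {t}).adicModuleTopology E) a := by
  have B := (Ideal.span {t}).adic_module_basis E
  let : TopologicalSpace R := (Ideal.span {t}).adic_basis.topology
  let : TopologicalSpace E := (Ideal.span {t}).adicModuleTopology E
  let F := ((Ideal.span {t}).ringFilterBasis.moduleFilterBasis
    ((Ideal.span {t}).adic_module_basis E)).toAddGroupFilterBasis
  have : IsTopologicalAddGroup E := F.isTopologicalAddGroup
  apply continuous_of_continuousAt_zero a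
  have HB : (nhds (0 : E)).HasBasis (fun _ : ℕ => True)
      (fun n => ((Ideal.span {t} ^ n • (⊤ : Submodule R E) : Submodule R E) : Set E)) := by
    refine ⟨fun U => ?_⟩
    refine F.nhds_zero_hasBasis.mem_iff.trans ⟨?_, ?_⟩
    · rintro ⟨-, ⟨i, rfl⟩, hi⟩
      exact ⟨i, trivial, hi⟩
    · rintro ⟨i, -, hi⟩
      exact ⟨_, ⟨i, rfl⟩, hi⟩
  rw [ContinuousAt, map_zero]
  refine (HB.tendsto_iff HB).2 fun n _ => ⟨n, trivial, fun x hx => ?_⟩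
  rw [Ideal.span_singleton_pow] at hx ⊢
  rw [SetLike.mem_coe, Submodule.ideal_span_singleton_smul,
    Submodule.mem_smul_pointwise_iff_exists] at hx ⊢
  obtain ⟨y, -, rfl⟩ := hx
  refine ⟨a y + ((n : R) * t) • y, trivial, ?_⟩
  rw [aux_pow h]
  module

theorem aux_add (b s t s' t' : R) (x y x' y' : E) :
    (s * s * (t * t)) • ((s * t) • (t • x' + (b * t') • x + (s • y' + (b * s') • y))
      - (b * (s * t' + t * s')) • (t • x + s • y)) =
    (s * t * (s * t)) • ((t * t) • (s • x' - (b * s') • x) + (s * s) • (t • y' - (b * t') • y)) := by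
  module

theorem aux_wd (b s t s' t' : R) {x y x' y' : E}
    (h1 : t • x = s • y) (h2 : t • x' + (b * t') • x = s • y' + (b * s') • y) :
    (t * t) • (s • x' - (b * s') • x) = (s * s) • (t • y' - (b * t') • y) := by
  linear_combination (norm := module) (s * t) • h2 - (b * t * s' + b * s * t') • h1

theorem aux_trunc (b n P T p p' T' : R) (x x' z : E) :
    (P * b) • z + (n * (P * b * b)) • T • x + (p • x' + (b ^ 2 * p') • x)
      - ((P * b * T + p) • x' + (b ^ 2 * (P * b * T' + T * (n * P * 1) + p')) • x) =
    (P * b) • (z - T • x' - (b ^ 2 * T') • x) := by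
  module

theorem aux_lam (S d : R) (x y z : E) :
    S • x + d • z - (S • y + d • z) = S • (x - y) := by
  module

theorem aux_lamX (b : R) (x y z : E) :
    -(b • x) - -(b • y + b ^ 2 • z) = -(b • (x - y)) + b ^ 2 • z := by
  module

end Identities

section Auxiliary

variable {E : Type u} [AddCommGroup E] [Module ℂ⟦X⟧ E]

/-- The `b`-adic topology on a `ℂ[[b]]`-module. -/
noncomputable abbrev bAdic (E : Type u) [AddCommGroup E] [Module ℂ⟦X⟧ E] : TopologicalSpace E :=
  (Ideal.span {(X : ℂ⟦X⟧)}).adicModuleTopology E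

theorem aux_continuous {a : E →+ E}
    (h : ∀ x, a ((X : ℂ⟦X⟧) • x) = (X : ℂ⟦X⟧) • a x + (X : ℂ⟦X⟧) ^ 2 • x) :
    @Continuous E E (bAdic E) (bAdic E) a :=
  aux_continuous_adic h

theorem aux_separated [Module.Free ℂ⟦X⟧ E] {x : E} (h : ∀ n : ℕ, ∃ y : E, x = (X : ℂ⟦X⟧) ^ n • y) :
    x = 0 := by
  let B := Module.Free.chooseBasis ℂ⟦X⟧ E
  refine B.ext_elem fun i => ?_
  ext m
  obtain ⟨y, rfl⟩ := h (m + 1)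
  simp only [map_smul, Finsupp.smul_apply, map_zero, Finsupp.coe_zero, Pi.zero_apply, smul_eq_mul]
  exact X_pow_dvd_iff.1 (dvd_mul_right _ _) m (Nat.lt_succ_self m)

/-- The commutation relation `a S(b) = S(b) a + b² S'(b)` for all `S ∈ ℂ[[b]]`. -/
theorem aux_smul [Module.Free ℂ⟦X⟧ E] {a : E →+ E} (hC : ∀ (c : ℂ) (x : E), a ((C c : ℂ⟦X⟧) • x) = (C c : ℂ⟦X⟧) • a x)
    (h : ∀ x, a ((X : ℂ⟦X⟧) • x) = (X : ℂ⟦X⟧) • a x + (X : ℂ⟦X⟧) ^ 2 • x) (S : ℂ⟦X⟧) (x : E) :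
    a (S • x) = S • a x + ((X : ℂ⟦X⟧) ^ 2 * derivative ℂ S) • x := by
  have hpoly : ∀ (p : Polynomial ℂ) (x : E), a ((p : ℂ⟦X⟧) • x) =
      (p : ℂ⟦X⟧) • a x + ((X : ℂ⟦X⟧) ^ 2 * derivative ℂ (p : ℂ⟦X⟧)) • x := by
    intro p x
    induction p using Polynomial.induction_on' with
    | add p q hp hq =>
      simp only [Polynomial.coe_add, map_add, add_smul, mul_add, hp, hq]
      abel
    | monomial n c =>
      have e : ((Polynomial.monomial n c : Polynomial ℂ) : ℂ⟦X⟧) = C c * X ^ n := by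
        rw [Polynomial.coe_monomial, X_pow_eq]
        ext m
        rw [coeff_C_mul, coeff_monomial, coeff_monomial]
        split_ifs <;> simp
      rw [e, mul_smul, hC, aux_pow h, Derivation.leibniz, derivative_C, derivative_pow, derivative_X]
      rcases n with _ | n
      · simp
      · simp only [Nat.add_sub_cancel, smul_eq_mul, smul_add, smul_smul]
        congr 2
        ring
  rw [← sub_eq_zero]
  refine aux_separated fun n => ?_
  obtain ⟨T, p, hS⟩ : ∃ (T : ℂ⟦X⟧) (p : Polynomial ℂ), S = X ^ n * T + (p : ℂ⟦X⟧) :=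
    ⟨_, _, eq_X_pow_mul_shift_add_trunc n S⟩
  refine ⟨a (T • x) - T • a x - (X ^ 2 * derivative ℂ T) • x, ?_⟩
  rw [hS, add_smul, map_add, hpoly, mul_smul, aux_pow h, map_add, Derivation.leibniz, derivative_pow,
    derivative_X]
  rcases n with _ | n
  · simp [add_smul, mul_add]
    abel
  · simp only [smul_eq_mul, Nat.add_sub_cancel, pow_succ X n, pow_succ X (n + 1)]
    exact aux_trunc _ _ _ _ _ _ _ _ _ _

end Auxiliary

end ABModule

/-- An (a,b)-module: a free `ℂ[[b]]`-module of finite type with an additive map `a`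
commuting with the scalars of `ℂ`, continuous for the `b`-adic topology, such that
`a b - b a = b²`. -/
structure ABModule : Type (u + 1) where
  carrier : Type u
  [addCommGroup : AddCommGroup carrier]
  [module : Module ℂ⟦X⟧ carrier]
  [free : Module.Free ℂ⟦X⟧ carrier]
  [finite : Module.Finite ℂ⟦X⟧ carrier]
  a : carrier →+ carrier
  a_const_smul : ∀ (c : ℂ) (x : carrier), a ((C c : ℂ⟦X⟧) • x) = (C c : ℂ⟦X⟧) • a x
  continuous_a : @Continuous carrier carrier (ABModule.bAdic carrier) (ABModule.bAdic carrier) a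
  a_b_sub_b_a : ∀ x : carrier,
    a ((X : ℂ⟦X⟧) • x) - (X : ℂ⟦X⟧) • a x = (X : ℂ⟦X⟧) ^ 2 • x

namespace ABModule

attribute [instance] addCommGroup module free finite

theorem a_X_smul (E : ABModule.{u}) (x : E.carrier) :
    E.a ((X : ℂ⟦X⟧) • x) = (X : ℂ⟦X⟧) • E.a x + (X : ℂ⟦X⟧) ^ 2 • x := by
  rw [← E.a_b_sub_b_a]; abel

theorem a_smul (E : ABModule.{u}) (S : ℂ⟦X⟧) (x : E.carrier) :
    E.a (S • x) = S • E.a x + ((X : ℂ⟦X⟧) ^ 2 * derivative ℂ S) • x :=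
  aux_smul E.a_const_smul E.a_X_smul S x

noncomputable section

/-! ### The localization `E[b⁻¹]` and the index -/

/-- `E[b⁻¹]`. -/
abbrev Loc (E : ABModule.{u}) : Type u :=
  LocalizedModule (Submonoid.powers (X : ℂ⟦X⟧)) E.carrier

/-- `E` seen inside `E[b⁻¹]`. -/
def lattice (E : ABModule.{u}) : Submodule ℂ⟦X⟧ E.Loc :=
  LinearMap.range (LocalizedModule.mkLinearMap (Submonoid.powers (X : ℂ⟦X⟧)) E.carrier)

/-- The operator `a` on `E[b⁻¹]`, determined by the commutation relation:
`a (s⁻¹ x) = s⁻¹ (a x) - s⁻² b² s' x` for `s` a power of `b`. -/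
def locA (E : ABModule.{u}) : E.Loc →+ E.Loc where
  toFun z := LocalizedModule.liftOn z
    (fun p => LocalizedModule.mk
      ((p.2 : ℂ⟦X⟧) • E.a p.1 - ((X : ℂ⟦X⟧) ^ 2 * derivative ℂ (p.2 : ℂ⟦X⟧)) • p.1)
      (p.2 * p.2)) (by
    rintro ⟨x, s⟩ ⟨y, t⟩ ⟨w, hw⟩
    have hw' : (w : ℂ⟦X⟧) • ((t : ℂ⟦X⟧) • x) = (w : ℂ⟦X⟧) • ((s : ℂ⟦X⟧) • y) := hw
    have hne : (w : ℂ⟦X⟧) ≠ 0 := by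
      obtain ⟨n, hn⟩ := w.2
      rw [← hn]
      exact pow_ne_zero _ X_ne_zero
    have h1 : (t : ℂ⟦X⟧) • x = (s : ℂ⟦X⟧) • y := smul_right_injective E.carrier hne hw'
    have h2 := congrArg E.a h1
    rw [a_smul, a_smul] at h2
    rw [LocalizedModule.mk_eq]
    refine ⟨1, ?_⟩
    simp only [one_smul, Submonoid.smul_def, Submonoid.coe_mul]
    exact aux_wd _ _ _ _ _ h1 h2)
  map_zero' := by
    rw [← LocalizedModule.zero_mk 1, LocalizedModule.liftOn_mk]
    simp
  map_add' z w := by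
    induction z, w using LocalizedModule.induction_on₂ with
    | h x y s t =>
      rw [LocalizedModule.mk_add_mk, LocalizedModule.liftOn_mk, LocalizedModule.liftOn_mk,
        LocalizedModule.liftOn_mk, LocalizedModule.mk_add_mk, LocalizedModule.mk_eq]
      refine ⟨1, ?_⟩
      simp only [one_smul, Submonoid.smul_def, Submonoid.coe_mul, map_add, a_smul,
        Derivation.leibniz, smul_eq_mul]
      exact aux_add _ _ _ _ _ _ _ _ _

theorem locA_mk (E : ABModule.{u}) (x : E.carrier) (s : Submonoid.powers (X : ℂ⟦X⟧)) :
    E.locA (LocalizedModule.mk x s) = LocalizedModule.mk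
      ((s : ℂ⟦X⟧) • E.a x - ((X : ℂ⟦X⟧) ^ 2 * derivative ℂ (s : ℂ⟦X⟧)) • x) (s * s) := by
  simp only [locA, AddMonoidHom.coe_mk, ZeroHom.coe_mk, LocalizedModule.liftOn_mk]

/-- The operator `b⁻¹ a` on `E[b⁻¹]`. -/
def invBA (E : ABModule.{u}) (z : E.Loc) : E.Loc :=
  LocalizedModule.divBy ⟨(X : ℂ⟦X⟧), Submonoid.mem_powers _⟩ (E.locA z)

/-- The saturation `E♯` of `E` by `b⁻¹ a` in `E[b⁻¹]`: the smallest submodule containing `E`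
and stable by `b⁻¹ a`. -/
def saturation (E : ABModule.{u}) : Submodule ℂ⟦X⟧ E.Loc :=
  sInf {F | E.lattice ≤ F ∧ ∀ z ∈ F, E.invBA z ∈ F}

/-- `E` is regular when `E♯` is finitely generated over `ℂ[[b]]`. -/
def IsRegular (E : ABModule.{u}) : Prop :=
  E.saturation.FG

/-- The submodule `b⁻ᵐ E` of `E[b⁻¹]`. As `b` acts bijectively on `E[b⁻¹]`, this is the set of
all `z` with `bᵐ z ∈ E`. -/
def invPowB (E : ABModule.{u}) (m : ℕ) : Submodule ℂ⟦X⟧ E.Loc :=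
  E.lattice.comap (LinearMap.lsmul ℂ⟦X⟧ E.Loc ((X : ℂ⟦X⟧) ^ m))

/-- The index `δ(E)`: the smallest `m ∈ ℕ` with `E♯ ⊆ b⁻ᵐ E`. -/
def index (E : ABModule.{u}) : ℕ :=
  sInf {m : ℕ | E.saturation ≤ E.invPowB m}

/-- For regular `E` the minimum defining the index is attained. -/
theorem IsRegular.isLeast_index {E : ABModule.{u}} (h : E.IsRegular) :
    IsLeast {m : ℕ | E.saturation ≤ E.invPowB m} E.index := by
  suffices hne : {m : ℕ | E.saturation ≤ E.invPowB m}.Nonempty from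
    ⟨Nat.sInf_mem hne, fun m hm => Nat.sInf_le hm⟩
  have hmono : ∀ {m n : ℕ}, m ≤ n → E.invPowB m ≤ E.invPowB n := by
    intro m n hmn z hz
    obtain ⟨k, rfl⟩ := Nat.exists_eq_add_of_le hmn
    have hz' : (X : ℂ⟦X⟧) ^ m • z ∈ E.lattice := hz
    have := E.lattice.smul_mem ((X : ℂ⟦X⟧) ^ k) hz'
    rw [smul_smul, ← pow_add, add_comm k m] at this
    exact this
  have hex : ∀ z : E.Loc, ∃ m, z ∈ E.invPowB m := by
    intro z
    induction z using LocalizedModule.induction_on with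
    | h x s =>
      obtain ⟨n, hn⟩ := s.2
      refine ⟨n, x, ?_⟩
      simp only at hn
      rw [LinearMap.lsmul_apply, LocalizedModule.mkLinearMap_apply, hn, LocalizedModule.smul'_mk]
      exact (LocalizedModule.mk_cancel s x).symm
  obtain ⟨T, hT⟩ := h
  choose f hf using hex
  refine ⟨T.sup f, ?_⟩
  show E.saturation ≤ _
  rw [← hT, Submodule.span_le]
  exact fun z hz => hmono (Finset.le_sup hz) (hf z)

/-! ### Duality -/

/-- The `ℂ[[b]]`-linear maps from `E` to `F`, on which `S(b)` acts by `S(-b)`. -/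
def TwistedHom (E : ABModule.{u}) (F : ABModule.{v}) : Type (max u v) :=
  E.carrier →ₗ[ℂ⟦X⟧] F.carrier

namespace TwistedHom

variable (E : ABModule.{u}) (F : ABModule.{v})

instance : AddCommGroup (TwistedHom E F) :=
  inferInstanceAs (AddCommGroup (E.carrier →ₗ[ℂ⟦X⟧] F.carrier))

instance : Module ℂ⟦X⟧ (TwistedHom E F) :=
  Module.compHom (E.carrier →ₗ[ℂ⟦X⟧] F.carrier) (evalNegHom : ℂ⟦X⟧ →+* ℂ⟦X⟧)

variable {E F}

/-- The underlying `ℂ[[b]]`-linear map. -/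
def toLin : TwistedHom E F ≃+ (E.carrier →ₗ[ℂ⟦X⟧] F.carrier) :=
  AddEquiv.refl _

theorem toLin_smul (S : ℂ⟦X⟧) (φ : TwistedHom E F) :
    toLin (S • φ) = evalNegHom S • toLin φ :=
  rfl

theorem evalNeg_evalNeg (S : ℂ⟦X⟧) : evalNegHom (evalNegHom S) = S := by
  rw [evalNegHom, rescale_rescale]
  simp

/-- The ring automorphism `S(b) ↦ S(-b)`. -/
def evalNegEquiv : ℂ⟦X⟧ ≃+* ℂ⟦X⟧ :=
  RingEquiv.ofRingHom evalNegHom evalNegHom (RingHom.ext evalNeg_evalNeg)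
    (RingHom.ext evalNeg_evalNeg)

/-- A basis of the twisted module obtained from a basis of the untwisted one. -/
def basis : Module.Basis
    (Module.Free.ChooseBasisIndex ℂ⟦X⟧ (E.carrier →ₗ[ℂ⟦X⟧] F.carrier)) ℂ⟦X⟧ (TwistedHom E F) :=
  @Module.Basis.mapCoeffs _ ℂ⟦X⟧ (TwistedHom E F) _ _
    (inferInstanceAs (Module ℂ⟦X⟧ (E.carrier →ₗ[ℂ⟦X⟧] F.carrier)))
    (Module.Free.chooseBasis ℂ⟦X⟧ (E.carrier →ₗ[ℂ⟦X⟧] F.carrier)) ℂ⟦X⟧ _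
    inferInstance evalNegEquiv (fun c x => by
      change toLin (evalNegHom c • x) = _
      rw [toLin_smul, evalNeg_evalNeg]
      rfl)

instance : Module.Free ℂ⟦X⟧ (TwistedHom E F) := Module.Free.of_basis basis

instance : Module.Finite ℂ⟦X⟧ (TwistedHom E F) := Module.Finite.of_basis basis

/-- The operator `Λ(φ)(e) = φ(a e) - a φ(e)`. -/
def lam : TwistedHom E F →+ TwistedHom E F where
  toFun φ := toLin.symm
    { toFun := fun e => toLin φ (E.a e) - F.a (toLin φ e)
      map_add' := fun x y => by simp only [map_add]; abel
      map_smul' := fun S x => by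
        simp only [a_smul, map_add, map_smul, RingHom.id_apply]
        exact aux_lam _ _ _ _ _ }
  map_zero' := by
    apply toLin.injective
    ext e
    simp
  map_add' φ ψ := by
    apply toLin.injective
    ext e
    simp
    abel

theorem toLin_lam (φ : TwistedHom E F) (e : E.carrier) :
    toLin (lam φ) e = toLin φ (E.a e) - F.a (toLin φ e) :=
  rfl

theorem lam_X_smul (φ : TwistedHom E F) :
    lam ((X : ℂ⟦X⟧) • φ) = (X : ℂ⟦X⟧) • lam φ + (X : ℂ⟦X⟧) ^ 2 • φ := by
  apply toLin.injective
  ext e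
  have h1 : toLin ((X : ℂ⟦X⟧) • φ) = -((X : ℂ⟦X⟧) • toLin φ) := by
    rw [toLin_smul, evalNegHom_X, neg_smul]
  have h2 : toLin ((X : ℂ⟦X⟧) • lam φ) = -((X : ℂ⟦X⟧) • toLin (lam φ)) := by
    rw [toLin_smul, evalNegHom_X, neg_smul]
  have h3 : toLin ((X : ℂ⟦X⟧) ^ 2 • φ) = (X : ℂ⟦X⟧) ^ 2 • toLin φ := by
    rw [toLin_smul, map_pow, evalNegHom_X, neg_sq]
  rw [map_add, LinearMap.add_apply, toLin_lam, h1, h2, h3]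
  simp only [LinearMap.neg_apply, LinearMap.smul_apply, toLin_lam, map_neg, a_X_smul]
  exact aux_lamX _ _ _ _

end TwistedHom

/-- The (a,b)-module `Hom_{a,b}(E,F)`: the module `Hom_b(E,F)` on which `S(b)` acts by `S(-b)`,
with `(a φ)(e) = φ(a e) - a φ(e)`. -/
def Hom (E : ABModule.{u}) (F : ABModule.{v}) : ABModule.{max u v} where
  carrier := TwistedHom E F
  a := TwistedHom.lam
  a_const_smul c φ := by
    have hc : evalNegHom (C c : ℂ⟦X⟧) = C c := by
      ext n
      rw [evalNegHom, coeff_rescale, coeff_C]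
      split_ifs with h <;> simp [h]
    apply TwistedHom.toLin.injective
    ext e
    simp only [TwistedHom.toLin_lam, TwistedHom.toLin_smul, LinearMap.smul_apply, hc,
      F.a_const_smul, smul_sub]
  continuous_a := aux_continuous TwistedHom.lam_X_smul
  a_b_sub_b_a φ := by rw [TwistedHom.lam_X_smul]; abel

/-- The operator `S ↦ b² S'` on `ℂ[[b]]`. -/
def rankOneA : ℂ⟦X⟧ →+ ℂ⟦X⟧ where
  toFun S := (X : ℂ⟦X⟧) ^ 2 * derivative ℂ S
  map_zero' := by simp
  map_add' S T := by simp [mul_add]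

theorem rankOneA_X_smul (S : ℂ⟦X⟧) :
    rankOneA ((X : ℂ⟦X⟧) • S) = (X : ℂ⟦X⟧) • rankOneA S + (X : ℂ⟦X⟧) ^ 2 • S := by
  simp [rankOneA, Derivation.leibniz]
  ring

/-- The rank one (a,b)-module `E₀ = ℂ[[b]] e₀` with `a e₀ = 0`, hence `a (S(b) e₀) = b² S'(b) e₀`. -/
def E₀ : ABModule.{0} where
  carrier := ℂ⟦X⟧
  a := rankOneA
  a_const_smul c S := by
    simp [rankOneA, Derivation.leibniz]
    ring
  continuous_a := aux_continuous rankOneA_X_smul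
  a_b_sub_b_a S := by rw [rankOneA_X_smul]; abel

/-- The dual `E* = Hom_{a,b}(E, E₀)`. -/
def dual (E : ABModule.{u}) : ABModule.{u} := Hom E E₀

end

end ABModule

namespace ABModule

/-- `E` contains a submodule `F` that is stable by `b⁻¹ a` and satisfies `bᵐ E ⊆ F`. -/
def HasSaturatedSubmodule (E : ABModule.{u}) (m : ℕ) : Prop :=
  ∃ F : Submodule ℂ⟦X⟧ E.carrier, (∀ x, (X : ℂ⟦X⟧) ^ m • x ∈ F) ∧
    ∀ x ∈ F, ∃ y ∈ F, E.a x = (X : ℂ⟦X⟧) • y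

/-! ### Module identities behind the commutation of `a` with `b`. -/

section Identities

variable {R : Type v} [CommRing R] {M : Type u} [AddCommGroup M] [Module R M]

theorem smul_identity_localization (b s s' : R) (x x' : M) :
    (s * s * s) • (s • (b • x' + b ^ 2 • x) - (b ^ 2 * s') • b • x) =
      (s * s) • (s • b • (s • x' - (b ^ 2 * s') • x) + (s * s) • b ^ 2 • x) := by
  module

/-- For `y = b⁻¹a z` and `n = m` this is `a bᵐ z = b · bᵐ (b⁻¹a + m) z`. -/
theorem smul_identity_saturation (b n : R) (m : ℕ) (y z : M) :
    b ^ m • b • y + (n * b ^ (m + 1)) • z = b • b ^ m • (y + n • z) := by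
  module

end Identities

/-! ### From the saturation in `E[b⁻¹]` to submodules of `E`. -/

section Localization

variable (E : ABModule.{u})

/-- The inclusion of `E` into `E[b⁻¹]`. -/
noncomputable abbrev toLoc : E.carrier →ₗ[ℂ⟦X⟧] E.Loc :=
  LocalizedModule.mkLinearMap (Submonoid.powers (X : ℂ⟦X⟧)) E.carrier

theorem X_pow_smul_injective (n : ℕ) :
    Function.Injective fun z : E.Loc => (X : ℂ⟦X⟧) ^ n • z :=
  IsLocalizedModule.smul_injective E.toLoc (⟨(X : ℂ⟦X⟧) ^ n, n, rfl⟩ : Submonoid.powers (X : ℂ⟦X⟧))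

theorem toLoc_injective : Function.Injective E.toLoc := by
  intro x y h
  obtain ⟨⟨-, n, rfl⟩, hc⟩ := (IsLocalizedModule.eq_iff_exists
    (Submonoid.powers (X : ℂ⟦X⟧)) E.toLoc).1 h
  exact smul_right_injective E.carrier (pow_ne_zero n (X_ne_zero (R := ℂ))) hc

theorem locA_toLoc (x : E.carrier) : E.locA (E.toLoc x) = E.toLoc (E.a x) := by
  simp [toLoc, locA_mk]

theorem locA_X_smul (z : E.Loc) :
    E.locA ((X : ℂ⟦X⟧) • z) = (X : ℂ⟦X⟧) • E.locA z + (X : ℂ⟦X⟧) ^ 2 • z := by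
  induction z using LocalizedModule.induction_on with
  | h x s =>
    rw [LocalizedModule.smul'_mk, locA_mk, locA_mk, LocalizedModule.smul'_mk,
      LocalizedModule.smul'_mk, LocalizedModule.mk_add_mk, a_X_smul, LocalizedModule.mk_eq]
    refine ⟨1, ?_⟩
    simp only [one_smul, Submonoid.smul_def, Submonoid.coe_mul]
    exact smul_identity_localization _ _ _ _ _

theorem X_smul_invBA (z : E.Loc) : (X : ℂ⟦X⟧) • E.invBA z = E.locA z :=
  LocalizedModule.mul_by_divBy (S := Submonoid.powers (X : ℂ⟦X⟧)) ⟨X, Submonoid.mem_powers _⟩ _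

theorem lattice_le_saturation : E.lattice ≤ E.saturation :=
  le_sInf fun _ hF => hF.1

theorem invBA_mem_saturation {z : E.Loc} (hz : z ∈ E.saturation) :
    E.invBA z ∈ E.saturation := by
  rw [saturation, Submodule.mem_sInf] at hz ⊢
  exact fun F hF => hF.2 z (hz F hF)

theorem saturation_le_invPowB_iff (m : ℕ) :
    E.saturation ≤ E.invPowB m ↔ E.HasSaturatedSubmodule m := by
  constructor
  · intro h
    refine ⟨(E.saturation.map (LinearMap.lsmul ℂ⟦X⟧ E.Loc (X ^ m))).comap E.toLoc,
      fun x => ⟨E.toLoc x, E.lattice_le_saturation ⟨x, rfl⟩, by simp⟩, ?_⟩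
    rintro x ⟨z, hz, hzx⟩
    -- The commutator of `a` with `bᵐ` turns `b⁻¹a` into `b⁻¹a + m`, and `E♯` is stable under both
    -- summands.
    have hw : E.invBA z + (m : ℂ⟦X⟧) • z ∈ E.saturation :=
      add_mem (E.invBA_mem_saturation hz) (E.saturation.smul_mem _ hz)
    obtain ⟨y, hy⟩ := h hw
    refine ⟨y, ⟨_, hw, hy.symm⟩, E.toLoc_injective ?_⟩
    rw [LinearMap.lsmul_apply] at hy hzx
    rw [← locA_toLoc, ← hzx, aux_pow E.locA_X_smul, map_smul, hy, ← X_smul_invBA]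
    exact smul_identity_saturation _ _ _ _ _
  · rintro ⟨F, hF, ha⟩
    -- `K = b⁻ᵐ F` contains `E` because `bᵐ E ⊆ F`; its stability makes it contain `E♯` by
    -- minimality.
    let K : Submodule ℂ⟦X⟧ E.Loc := (F.map E.toLoc).comap (LinearMap.lsmul ℂ⟦X⟧ E.Loc (X ^ m))
    have hK : E.saturation ≤ K := by
      refine sInf_le ⟨?_, ?_⟩
      · rintro - ⟨x, rfl⟩
        exact ⟨_, hF x, by simp⟩
      · rintro z ⟨x, hx, hxz⟩
        obtain ⟨y, hy, hxy⟩ := ha x hx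
        -- If `x = bᵐ z` and `a x = b y`, then `bᵐ (b⁻¹a z) = y - m x`; this is checked after
        -- multiplying by `b`.
        refine ⟨y - (m : ℂ⟦X⟧) • x, sub_mem hy (F.smul_mem _ hx),
          E.X_pow_smul_injective 1 ?_⟩
        rw [LinearMap.lsmul_apply] at hxz ⊢
        have h1 := E.locA_toLoc x
        rw [hxz, aux_pow E.locA_X_smul, hxy, map_smul, ← X_smul_invBA] at h1
        simp only [pow_one, map_sub, map_smul, hxz, smul_sub, ← h1]
        rw [smul_identity_saturation, smul_add, smul_add, smul_comm (X ^ m) (m : ℂ⟦X⟧),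
          add_sub_cancel_right]
    exact hK.trans (Submodule.comap_mono (LinearMap.map_le_range))

/-- Multiplication by `bᵐ` embeds `b⁻ᵐ E` into the lattice `E`, which is noetherian. -/
theorem invPowB_fg (m : ℕ) : (E.invPowB m).FG := by
  have hl : E.lattice.FG := by
    rw [lattice, LinearMap.range_eq_map]
    exact Module.Finite.fg_top.map _
  have : IsNoetherian ℂ⟦X⟧ E.lattice := isNoetherian_of_fg_of_noetherian _ hl
  refine Submodule.fg_of_fg_map_injective (LinearMap.lsmul ℂ⟦X⟧ E.Loc (X ^ m))
    (E.X_pow_smul_injective m) ?_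
  exact hl.of_le (Submodule.map_comap_le _ _)

theorem isRegular_iff : E.IsRegular ↔ ∃ m, E.HasSaturatedSubmodule m := by
  simp only [← saturation_le_invPowB_iff]
  exact ⟨fun h => ⟨_, h.isLeast_index.1⟩, fun ⟨m, h⟩ => (E.invPowB_fg m).of_le h⟩

theorem index_eq_sInf : E.index = sInf {m | E.HasSaturatedSubmodule m} := by
  simp only [index, saturation_le_invPowB_iff]

end Localization

/-! ### Polars under the pairing of `E*` with `E`. -/

section Duality

variable {E : ABModule.{u}}

/-- The value of an element of the dual at an element of `E`. -/
noncomputable def pairing (φ : E.dual.carrier) : E.carrier →ₗ[ℂ⟦X⟧] ℂ⟦X⟧ :=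
  TwistedHom.toLin (E := E) (F := E₀) φ

theorem pairing_injective : Function.Injective (pairing (E := E)) :=
  (TwistedHom.toLin (E := E) (F := E₀)).injective

theorem pairing_surjective : Function.Surjective (pairing (E := E)) :=
  (TwistedHom.toLin (E := E) (F := E₀)).surjective

theorem pairing_smul (S : ℂ⟦X⟧) (φ : E.dual.carrier) (e : E.carrier) :
    pairing (S • φ) e = evalNegHom S * pairing φ e :=
  rfl

theorem pairing_a (φ : E.dual.carrier) (e : E.carrier) :
    pairing (E.dual.a φ) e = pairing φ (E.a e) - X ^ 2 * derivative ℂ (pairing φ e) :=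
  rfl

theorem pairing_X_smul (φ : E.dual.carrier) (e : E.carrier) :
    pairing ((X : ℂ⟦X⟧) • φ) e = -(X * pairing φ e) := by
  rw [pairing_smul, evalNegHom_X, neg_mul]

theorem pairing_X_pow_smul (m : ℕ) (φ : E.dual.carrier) (e : E.carrier) :
    pairing ((X : ℂ⟦X⟧) ^ m • φ) e = (-1) ^ m * (X ^ m * pairing φ e) := by
  rw [pairing_smul, map_pow, evalNegHom_X, neg_pow, mul_assoc]

/-- The Euler operator `b d/db` preserves each ideal `(bᵐ)`; it is the `b⁻¹a` of `E₀`. -/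
theorem X_pow_dvd_X_mul_derivative {m : ℕ} {S : ℂ⟦X⟧} (h : X ^ m ∣ S) :
    X ^ m ∣ X * derivative ℂ S := by
  obtain ⟨T, rfl⟩ := h
  rw [Derivation.leibniz, derivative_pow, derivative_X]
  rcases m with _ | m
  · simp
  · refine ⟨X * derivative ℂ T + ((m + 1 : ℕ) : ℂ⟦X⟧) * T, ?_⟩
    simp only [smul_eq_mul, Nat.add_sub_cancel]
    ring

/-- It suffices to test on the coordinate forms of a basis. -/
theorem exists_eq_X_smul_of_pairing {x : E.carrier} (h : ∀ φ, X ∣ pairing φ x) :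
    ∃ y, x = (X : ℂ⟦X⟧) • y := by
  let B := Module.Free.chooseBasis ℂ⟦X⟧ E.carrier
  have hB : ∀ i, ∃ c, B.repr x i = X * c := fun i => by
    obtain ⟨φ, hφ⟩ := pairing_surjective (E := E) (B.coord i)
    have := h φ
    rwa [hφ] at this
  choose c hc using hB
  refine ⟨∑ i, c i • B i, ?_⟩
  conv_lhs => rw [← B.sum_repr x]
  simp only [hc, mul_smul, Finset.smul_sum]

theorem exists_eq_X_smul_of_forall_pairing {φ : E.dual.carrier} (h : ∀ e, X ∣ pairing φ e) :
    ∃ ψ, φ = (X : ℂ⟦X⟧) • ψ := by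
  choose c hc using h
  obtain ⟨ψ, hψ⟩ := pairing_surjective (E := E)
    { toFun := fun e => -c e
      map_add' := fun x y => mul_left_cancel₀ (X_ne_zero (R := ℂ)) (by
        rw [mul_add]; simp only [mul_neg, ← hc, map_add]; ring)
      map_smul' := fun S x => mul_left_cancel₀ (X_ne_zero (R := ℂ)) (by
        rw [RingHom.id_apply, smul_eq_mul, mul_left_comm]
        simp only [mul_neg, ← hc, map_smul, smul_eq_mul]) }
  refine ⟨ψ, pairing_injective (LinearMap.ext fun e => ?_)⟩
  rw [pairing_X_smul, hψ]
  simp [hc]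

theorem HasSaturatedSubmodule.dual {m : ℕ} (h : E.HasSaturatedSubmodule m) :
    E.dual.HasSaturatedSubmodule m := by
  obtain ⟨F, hF, ha⟩ := h
  refine ⟨{ carrier := {φ | ∀ e ∈ F, X ^ m ∣ pairing φ e}
            add_mem' := fun hφ hψ e he => dvd_add (hφ e he) (hψ e he)
            zero_mem' := fun e _ => dvd_zero _
            smul_mem' := fun S φ hφ e he => (hφ e he).mul_left _ },
    fun φ e _ => ?_, fun φ hφ => ?_⟩
  · rw [pairing_X_pow_smul]
    exact (dvd_mul_right _ _).mul_left _
  · obtain ⟨ψ, hψ⟩ : ∃ ψ, E.dual.a φ = (X : ℂ⟦X⟧) • ψ := by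
      refine exists_eq_X_smul_of_forall_pairing fun e => ?_
      -- An arbitrary `e` need not lie in `F`, but `bᵐ e` does. Applying `φ` to `a bᵐ e = b f` and
      -- cancelling `bᵐ` gives `b ∣ φ(a e)`.
      obtain ⟨f, hf, hef⟩ := ha _ (hF e)
      obtain ⟨c, hc⟩ := hφ f hf
      have h1 := congrArg (pairing φ) hef
      rw [aux_pow E.a_X_smul, map_add, map_smul, map_smul, map_smul, hc] at h1
      simp only [smul_eq_mul] at h1
      rw [pairing_a]
      refine dvd_sub ⟨c - m * pairing φ e, ?_⟩ ((dvd_pow_self _ two_ne_zero).mul_right _)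
      refine mul_left_cancel₀ (pow_ne_zero m (X_ne_zero (R := ℂ))) ?_
      linear_combination h1
    refine ⟨ψ, fun e he => ?_, hψ⟩
    obtain ⟨f, hf, hef⟩ := ha e he
    have h1 := pairing_a φ e
    rw [hψ, pairing_X_smul, hef, map_smul, smul_eq_mul] at h1
    -- Both terms lie in `(bᵐ)`: the first by the Euler operator, the second because `f ∈ F`.
    have h2 : pairing ψ e = X * derivative ℂ (pairing φ e) - pairing φ f := by
      refine mul_left_cancel₀ (X_ne_zero (R := ℂ)) ?_
      linear_combination -h1
    rw [h2]
    exact dvd_sub (X_pow_dvd_X_mul_derivative (hφ e he)) (hφ f hf)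

/-- The polar argument with the roles of `E` and `E*` exchanged; the twisted action brings in
factors `(-1)ᵐ`. -/
theorem HasSaturatedSubmodule.of_dual {m : ℕ} (h : E.dual.HasSaturatedSubmodule m) :
    E.HasSaturatedSubmodule m := by
  obtain ⟨G, hG, ha⟩ := h
  refine ⟨{ carrier := {e | ∀ φ ∈ G, X ^ m ∣ pairing φ e}
            add_mem' := fun hx hy φ hφ => by
              rw [map_add]
              exact dvd_add (hx φ hφ) (hy φ hφ)
            zero_mem' := fun φ _ => by
              rw [map_zero]
              exact dvd_zero _
            smul_mem' := fun S e he φ hφ => by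
              rw [map_smul]
              exact (he φ hφ).mul_left _ },
    fun e φ _ => ?_, fun e he => ?_⟩
  · rw [map_smul]
    exact dvd_mul_right _ _
  · obtain ⟨f, hf⟩ : ∃ f, E.a e = (X : ℂ⟦X⟧) • f := by
      refine exists_eq_X_smul_of_pairing fun φ => ?_
      obtain ⟨ψ, hψ, hφψ⟩ := ha _ (hG φ)
      obtain ⟨c, hc⟩ := he ψ hψ
      have h1 := congrArg (pairing · e) hφψ
      simp only [pairing_a, pairing_X_smul, hc, pairing_X_pow_smul] at h1
      have h2 : (-1 : ℂ⟦X⟧) ^ m * (-1) ^ m = 1 := by rw [← mul_pow]; simp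
      have h3 : derivative ℂ ((-1 : ℂ⟦X⟧) ^ m * (X ^ m * pairing φ e)) =
          (-1) ^ m * derivative ℂ (X ^ m * pairing φ e) := by
        rcases neg_one_pow_eq_or ℂ⟦X⟧ m with h | h <;> simp [h]
      obtain ⟨d, hd⟩ := X_pow_dvd_X_mul_derivative (dvd_mul_right (X ^ m) (pairing φ e))
      rw [h3] at h1
      -- With `b (bᵐ φ(e))' = bᵐ d` and `ψ(e) = bᵐ c`, evaluating `a (bᵐ φ) = b ψ` at `e` gives `bᵐ
      -- φ(a e) = bᵐ⁺¹ (d - (-1)ᵐ c)`.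
      refine ⟨d - (-1) ^ m * c, ?_⟩
      refine mul_left_cancel₀ (pow_ne_zero m (X_ne_zero (R := ℂ))) ?_
      linear_combination (-1) ^ m * h1 + X * hd - h2 * (X ^ m * pairing φ (E.a e) -
        X ^ 2 * derivative ℂ (X ^ m * pairing φ e))
    refine ⟨f, fun φ hφ => ?_, hf⟩
    obtain ⟨ψ, hψ, hφψ⟩ := ha φ hφ
    have h1 := pairing_a φ e
    rw [hφψ, pairing_X_smul, hf, map_smul, smul_eq_mul] at h1
    have h2 : pairing φ f = X * derivative ℂ (pairing φ e) - pairing ψ e := by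
      refine mul_left_cancel₀ (X_ne_zero (R := ℂ)) ?_
      linear_combination -h1
    rw [h2]
    exact dvd_sub (X_pow_dvd_X_mul_derivative (he φ hφ)) (he ψ hψ)

theorem hasSaturatedSubmodule_dual_iff {m : ℕ} :
    E.dual.HasSaturatedSubmodule m ↔ E.HasSaturatedSubmodule m :=
  ⟨.of_dual, .dual⟩

end Duality

end ABModule

theorem mainTheorem8 (E : ABModule.{u}) (hE : E.IsRegular) :
    E.dual.IsRegular ∧ E.dual.index = E.index := by
  rw [ABModule.isRegular_iff] at hE ⊢
  simpa only [ABModule.index_eq_sInf, ABModule.hasSaturatedSubmodule_dual_iff, and_true] using hE
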